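/- Let $G$ be a graph with node set $[n]$, let $K_1,\dots,K_m\subseteq[n]$ be a clique cover of $G$ (every $K_j$ is a clique, and every edge and every node of $G$ lies in some $K_j$), let $c\in\mathbb R^n$ and $T>0$. Put $c_{n+j}=0$ and $\bar K_j=K_j\cup\{n+j\}$ for $j\in[m]$ (slack variables), $J_i=\{j\in[m]: i\in\bar K_j\}$ for $i\in[n+m]$, and for $\lambda\in\mathbb R^m$ let $c^\lambda_i=c_i-\sum_{j\in J_i}\lambda_j$ be the reduced costs. With $H(x)=-\sum_{i=1}^{n+m}(x_i\log x_i-x_i)$ (where $0\log 0=0$), define the smoothed dual $$D^T(\lambda)=\sum_{j=1}^m\lambda_j+\max_{x\in[0,1]^{n+m}}\bigl(\langle c^\lambda,x\rangle+T\,H(x)\bigr),\qquad \lambda\in\mathbb R^m .$$ The log-domain Bregman algorithm starts from an arbitrary $\lambda\in\mathbb R^m$ and repeats forever: for $j=1,\dots,m$ in this order (processing the clique $j$), choose $i^*\in\operatorname{argmax}_{i\in\bar K_j}c^\lambda_i$ and set $$\lambda_j:=\lambda_j+c^\lambda_{i^*}+T\log\sum_{i\in\bar K_j}\exp\frac{c^\lambda_i-c^\lambda_{i^*}}{T}.$$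 Then: 1. $D^T$ is convex and differentiable on $\mathbb R^m$. 2. The algorithm is exact coordinate minimization: whenever processing the clique $j$ turns $\lambda$ into $\lambda'$, the vectors $\lambda'$ and $\lambda$ agree outside the coordinate $j$, $\lambda'$ minimizes $D^T$ over all vectors that agree with $\lambda$ outside the coordinate $j$, and $\frac{\partial D^T}{\partial\lambda_j}(\lambda')=0$. 3. The algorithm converges to the optimum of $\min_{\lambda\in\mathbb R^m}D^T(\lambda)$: for every initial vector and every choice of the maximizers $i^*$, there is a minimizer $\lambda^*$ of $D^T$ over $\mathbb R^m$ such that the sequence of all iterates (after each processed clique) converges to $\lambda^*$, and the values of $D^T$ along it converge to $D^T(\lambda^*)=\min D^T$. -/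

import Mathlib

open Filter Topology

noncomputable section

namespace CliqueMWIS

/-- The family `K j`, `j ∈ [m]`, is a clique cover of the graph `G` on the nodes `[n]`: every `K j`
is a clique, and every edge and every node of `G` lies in some `K j`. -/
structure IsCliqueCover {n m : ℕ} (G : SimpleGraph (Fin n)) (K : Fin m → Finset (Fin n)) :
    Prop where
  clique : ∀ j, G.IsClique (K j : Set (Fin n))
  edge : ∀ i i', G.Adj i i' → ∃ j, i ∈ K j ∧ i' ∈ K j
  node : ∀ i, ∃ j, i ∈ K j

/-- The index set of the variables: `Sum.inl i` is the node `i`, `Sum.inr j` is the slack variable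
`n + j` of the clique `j`. -/
abbrev Var (n m : ℕ) : Type := Fin n ⊕ Fin m

/-- The cost vector on all `n + m` variables; slack variables cost `0`. -/
def cost {n m : ℕ} (c : Fin n → ℝ) : Var n m → ℝ := Sum.elim c (fun _ => 0)

/-- The clique `K j` together with its slack variable. -/
def extClique {n m : ℕ} (K : Fin m → Finset (Fin n)) (j : Fin m) : Finset (Var n m) :=
  (K j).disjSum {j}

/-- The constraints that contain the variable `i`. -/
def cliquesOf {n m : ℕ} (K : Fin m → Finset (Fin n)) (i : Var n m) : Finset (Fin m) :=
  Finset.univ.filter (fun j => i ∈ extClique K j)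

/-- The reduced (reparametrized) costs. -/
def reducedCost {n m : ℕ} (K : Fin m → Finset (Fin n)) (c : Fin n → ℝ) (lam : Fin m → ℝ) :
    Var n m → ℝ :=
  fun i => cost c i - ∑ j ∈ cliquesOf K i, lam j

/-- The entropy shifted by a linear function (with `0 log 0 = 0`). -/
def entropy {n m : ℕ} (x : Var n m → ℝ) : ℝ := - ∑ i, (x i * Real.log (x i) - x i)

/-- The objective `⟨v, x⟩ + T H(x)`. -/
def smoothedObjective {n m : ℕ} (T : ℝ) (v x : Var n m → ℝ) : ℝ :=
  ∑ i, v i * x i + T * entropy x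

/-- The maximum of `⟨v, x⟩ + T H(x)` over the box `[0,1]^(n+m)`; it is attained, see
`smoothedMax_isGreatest`. -/
def smoothedMax {n m : ℕ} (T : ℝ) (v : Var n m → ℝ) : ℝ :=
  sSup (smoothedObjective T v '' Set.Icc 0 1)

theorem smoothedMax_isGreatest {n m : ℕ} (T : ℝ) (v : Var n m → ℝ) :
    IsGreatest (smoothedObjective T v '' Set.Icc 0 1) (smoothedMax T v) := by
  have hc : Continuous (smoothedObjective (n := n) (m := m) T v) := by
    unfold smoothedObjective entropy
    have h : ∀ i : Var n m, Continuous fun x : Var n m → ℝ => x i * Real.log (x i) := fun i =>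
      Real.continuous_mul_log.comp (continuous_apply i)
    fun_prop
  exact (isCompact_Icc.image hc).isGreatest_sSup
    ((Set.nonempty_Icc.2 zero_le_one).image _)

/-- The objective of the dual smoothed clique cover relaxation. -/
def smoothedDual {n m : ℕ} (K : Fin m → Finset (Fin n)) (c : Fin n → ℝ) (T : ℝ)
    (lam : Fin m → ℝ) : ℝ :=
  ∑ j, lam j + smoothedMax T (reducedCost K c lam)

/-- Processing the clique `j` may turn `lam` into `lam'`: for some maximizer `i₀` of the reduced
costs in the (extended) clique, `lam j` is increased by
`c_{i₀} + T log ∑_i exp ((c_i - c_{i₀}) / T)`. -/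
def ProcessClique {n m : ℕ} (K : Fin m → Finset (Fin n)) (c : Fin n → ℝ) (T : ℝ) (j : Fin m)
    (lam lam' : Fin m → ℝ) : Prop :=
  ∃ i₀ ∈ extClique K j,
    (∀ i ∈ extClique K j, reducedCost K c lam i ≤ reducedCost K c lam i₀) ∧
    lam' = Function.update lam j
      (lam j + reducedCost K c lam i₀ +
        T * Real.log (∑ i ∈ extClique K j,
          Real.exp ((reducedCost K c lam i - reducedCost K c lam i₀) / T)))

/-- A run (without a stopping criterion) of the log-domain Bregman algorithm: `lam t p` is the dual
vector in the outer iteration `t` after the first `p` cliques have been processed. The initial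
vector `lam 0 0` and the choice of the maximizers are arbitrary. -/
structure IsRun {n m : ℕ} (K : Fin m → Finset (Fin n)) (c : Fin n → ℝ) (T : ℝ)
    (lam : ℕ → Fin (m + 1) → Fin m → ℝ) : Prop where
  inner : ∀ t (j : Fin m), ProcessClique K c T j (lam t j.castSucc) (lam t j.succ)
  outer : ∀ t, lam (t + 1) 0 = lam t (Fin.last m)

end CliqueMWIS

end

/-! The maximum over the box splits over the variables, so D^T is the sum of the λ_j plus a C¹
convex scalar function of each reduced cost, with derivative min(1, exp(v/T)). Processing a clique
rescales its values exp(c^λ_i/T) to total mass 1; each is then at most 1, so the clipping is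
inactive on that clique and ∂D^T/∂λ_j = 0.

Convergence is proved with a different potential, `expDual`, the dual without the bounds x ≤ 1. A
step on a clique of mass M lowers it by T(M - 1 - log M), which is positive unless M = 1. The slack
terms make it coercive, so the iterates stay in a compact box. At a cluster point a whole sweep
loses nothing, hence all masses are 1. Only one point has this property, so the sequence converges
to it; the gradient of D^T vanishes there, which makes it a minimizer. -/

noncomputable section

namespace CliqueMWIS

/-! ### Scalar conjugate of the entropy on [0, 1] -/

/-- The maximizer of `x ↦ v * x - T * (x * log x - x)` over `[0, 1]`. -/
def clippedExp (T v : ℝ) : ℝ := min 1 (Real.exp (v / T))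

/-- The maximum of `x ↦ v * x - T * (x * log x - x)` over `[0, 1]`. -/
def conjEntropy (T v : ℝ) : ℝ := if v ≤ 0 then T * Real.exp (v / T) else v + T

variable {T : ℝ}

theorem exp_div_le_one (hT : 0 < T) {v : ℝ} : Real.exp (v / T) ≤ 1 ↔ v ≤ 0 := by
  rw [Real.exp_le_one_iff, div_le_iff₀ hT, zero_mul]

theorem clippedExp_of_nonpos (hT : 0 < T) {v : ℝ} (hv : v ≤ 0) :
    clippedExp T v = Real.exp (v / T) :=
  min_eq_right ((exp_div_le_one hT).2 hv)

theorem clippedExp_of_pos (hT : 0 < T) {v : ℝ} (hv : 0 < v) : clippedExp T v = 1 :=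
  min_eq_left (Real.one_le_exp (div_nonneg hv.le hT.le))

theorem conjEntropy_of_nonneg {v : ℝ} (hv : 0 ≤ v) : conjEntropy T v = v + T := by
  unfold conjEntropy
  split_ifs with h
  · obtain rfl : v = 0 := le_antisymm h hv
    simp
  · rfl

theorem clippedExp_mem_Icc (T v : ℝ) : clippedExp T v ∈ Set.Icc (0 : ℝ) 1 :=
  ⟨le_min zero_le_one (Real.exp_pos _).le, min_le_left _ _⟩

theorem clippedExp_attains (hT : 0 < T) (v : ℝ) :
    v * clippedExp T v - T * (clippedExp T v * Real.log (clippedExp T v) - clippedExp T v) =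
      conjEntropy T v := by
  rcases le_or_gt v 0 with hv | hv
  · rw [clippedExp_of_nonpos hT hv, conjEntropy, if_pos hv, Real.log_exp]
    field_simp
    ring
  · rw [clippedExp_of_pos hT hv, conjEntropy, if_neg hv.not_ge, Real.log_one]
    ring

theorem le_conjEntropy (hT : 0 < T) (v : ℝ) {x : ℝ} (hx : x ∈ Set.Icc (0 : ℝ) 1) :
    v * x - T * (x * Real.log x - x) ≤ conjEntropy T v := by
  obtain ⟨h0, h1⟩ := hx
  -- Fenchel–Young without the bound x ≤ 1: `t + 1 ≤ exp t` at t = w/T - log x, times T x.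
  have key : ∀ w : ℝ, w * x - T * (x * Real.log x - x) ≤ T * Real.exp (w / T) := by
    intro w
    rcases h0.eq_or_lt with rfl | h0
    · simpa using mul_nonneg hT.le (Real.exp_pos _).le
    · have h := Real.add_one_le_exp (w / T - Real.log x)
      rw [Real.exp_sub, Real.exp_log h0, le_div_iff₀ h0] at h
      have h' := mul_le_mul_of_nonneg_left h hT.le
      have e : T * ((w / T - Real.log x + 1) * x) = w * x - T * (x * Real.log x - x) := by
        field_simp
        ring
      linarith
  unfold conjEntropy
  split_ifs with hv
  · exact key v
  -- For v > 0 the entropy part is at most T, and v x ≤ v.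
  · have h := key 0
    rw [zero_div, Real.exp_zero] at h
    nlinarith

/-- `clippedExp T` is a subgradient of the convex function `conjEntropy T`. -/
theorem conjEntropy_subgradient (hT : 0 < T) (a b : ℝ) :
    conjEntropy T a + clippedExp T a * (b - a) ≤ conjEntropy T b := by
  have h := le_conjEntropy hT b (clippedExp_mem_Icc T a)
  rw [← clippedExp_attains hT a]
  linarith

theorem continuous_clippedExp (T : ℝ) : Continuous (clippedExp T) := by
  unfold clippedExp
  fun_prop

theorem continuous_conjEntropy (T : ℝ) : Continuous (conjEntropy T) := by
  unfold conjEntropy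
  refine Continuous.if_le (by fun_prop) (by fun_prop) continuous_id continuous_const ?_
  rintro x rfl
  simp

theorem hasDerivAt_conjEntropy (hT : 0 < T) (v : ℝ) :
    HasDerivAt (conjEntropy T) (clippedExp T v) v := by
  have off : ∀ w : ℝ, w ≠ 0 → HasDerivAt (conjEntropy T) (clippedExp T w) w := by
    intro w hw
    rcases lt_or_gt_of_ne hw with hw | hw
    · have h : HasDerivAt (fun u => T * Real.exp (u / T)) (clippedExp T w) w := by
        have e : T * (Real.exp (w / T) * (1 / T)) = clippedExp T w := by
          rw [clippedExp_of_nonpos hT hw.le]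
          field_simp
        exact e ▸ (((hasDerivAt_id w).div_const T).exp).const_mul T
      refine h.congr_of_eventuallyEq ?_
      filter_upwards [Iio_mem_nhds hw] with u hu
      exact if_pos (le_of_lt hu)
    · rw [clippedExp_of_pos hT hw]
      refine ((hasDerivAt_id w).add_const T).congr_of_eventuallyEq ?_
      filter_upwards [Ioi_mem_nhds hw] with u hu
      exact conjEntropy_of_nonneg (le_of_lt hu)
  rcases eq_or_ne v 0 with rfl | hv
  -- At the junction 0 the derivative is the limit of the derivatives nearby.
  · exact hasDerivAt_of_hasDerivAt_of_ne off (continuous_conjEntropy T).continuousAt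
      (continuous_clippedExp T).continuousAt
  · exact off v hv

/-! ### Convexity and differentiability of the smoothed dual -/

variable {n m : ℕ}

theorem smoothedObjective_eq_sum (T : ℝ) (v x : Var n m → ℝ) :
    smoothedObjective T v x = ∑ i, (v i * x i - T * (x i * Real.log (x i) - x i)) := by
  rw [smoothedObjective, entropy, Finset.sum_sub_distrib (fun i => v i * x i), ← Finset.mul_sum,
    mul_neg, sub_eq_add_neg]

theorem smoothedMax_eq_sum (hT : 0 < T) (v : Var n m → ℝ) :
    smoothedMax T v = ∑ i, conjEntropy T (v i) := by
  refine (smoothedMax_isGreatest T v).unique ⟨⟨fun i => clippedExp T (v i), ?_, ?_⟩, ?_⟩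
  · exact ⟨fun i => (clippedExp_mem_Icc T (v i)).1, fun i => (clippedExp_mem_Icc T (v i)).2⟩
  · rw [smoothedObjective_eq_sum]
    exact Finset.sum_congr rfl fun i _ => clippedExp_attains hT (v i)
  · rintro _ ⟨x, hx, rfl⟩
    rw [smoothedObjective_eq_sum]
    exact Finset.sum_le_sum fun i _ => le_conjEntropy hT (v i) ⟨hx.1 i, hx.2 i⟩

theorem smoothedDual_eq (K : Fin m → Finset (Fin n)) (c : Fin n → ℝ) (hT : 0 < T)
    (lam : Fin m → ℝ) :
    smoothedDual K c T lam = ∑ j, lam j + ∑ i, conjEntropy T (reducedCost K c lam i) := by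
  rw [smoothedDual, smoothedMax_eq_sum hT]

/-- Double counting of incidences: it moves sums over variables to sums over multipliers. -/
theorem sum_mul_sum_cliquesOf (K : Fin m → Finset (Fin n)) (w : Var n m → ℝ) (d : Fin m → ℝ) :
    ∑ i, w i * ∑ j ∈ cliquesOf K i, d j = ∑ j, d j * ∑ i ∈ extClique K j, w i := by
  simp only [cliquesOf, Finset.mul_sum, Finset.sum_filter, mul_ite, mul_zero]
  rw [Finset.sum_comm]
  refine Finset.sum_congr rfl fun j _ => ?_
  rw [← Finset.sum_filter, Finset.filter_univ_mem]
  exact Finset.sum_congr rfl fun i _ => mul_comm _ _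

theorem reducedCost_sub (K : Fin m → Finset (Fin n)) (c : Fin n → ℝ) (lam mu : Fin m → ℝ)
    (i : Var n m) :
    reducedCost K c mu i - reducedCost K c lam i = -∑ j ∈ cliquesOf K i, (mu j - lam j) := by
  simp only [reducedCost, Finset.sum_sub_distrib]
  ring

theorem reducedCost_inr (K : Fin m → Finset (Fin n)) (c : Fin n → ℝ) (lam : Fin m → ℝ)
    (j : Fin m) : reducedCost K c lam (Sum.inr j) = -lam j := by
  have : cliquesOf K (Sum.inr j) = {j} := by
    ext k
    simp [cliquesOf, extClique, eq_comm]
  simp [reducedCost, this, cost]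

theorem continuous_reducedCost (K : Fin m → Finset (Fin n)) (c : Fin n → ℝ) (i : Var n m) :
    Continuous fun lam => reducedCost K c lam i := by
  unfold reducedCost
  fun_prop

theorem differentiable_reducedCost (K : Fin m → Finset (Fin n)) (c : Fin n → ℝ) (i : Var n m) :
    Differentiable ℝ fun lam => reducedCost K c lam i := by
  unfold reducedCost
  fun_prop

/-- Sum of the scalar subgradient inequalities. Convexity and both minimality statements rest on it.
-/
theorem smoothedDual_subgradient (K : Fin m → Finset (Fin n)) (c : Fin n → ℝ) (hT : 0 < T)
    (lam mu : Fin m → ℝ) :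
    smoothedDual K c T lam + ∑ j, (mu j - lam j) *
        (1 - ∑ i ∈ extClique K j, clippedExp T (reducedCost K c lam i)) ≤
      smoothedDual K c T mu := by
  rw [smoothedDual_eq K c hT, smoothedDual_eq K c hT]
  have h : ∑ i, (conjEntropy T (reducedCost K c lam i) + clippedExp T (reducedCost K c lam i) *
      (reducedCost K c mu i - reducedCost K c lam i)) ≤
      ∑ i, conjEntropy T (reducedCost K c mu i) :=
    Finset.sum_le_sum fun i _ => conjEntropy_subgradient hT _ _
  simp only [reducedCost_sub, mul_neg, Finset.sum_add_distrib, Finset.sum_neg_distrib,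
    sum_mul_sum_cliquesOf] at h
  simp only [mul_sub, mul_one, Finset.sum_sub_distrib, sub_mul] at h ⊢
  linarith

theorem convexOn_smoothedDual (K : Fin m → Finset (Fin n)) (c : Fin n → ℝ) (hT : 0 < T) :
    ConvexOn ℝ Set.univ (smoothedDual K c T) := by
  refine ⟨convex_univ, fun x _ y _ a b ha hb hab => ?_⟩
  set z := a • x + b • y with hz
  have hx := mul_le_mul_of_nonneg_left (smoothedDual_subgradient K c hT z x) ha
  have hy := mul_le_mul_of_nonneg_left (smoothedDual_subgradient K c hT z y) hb
  set w : Fin m → ℝ := fun j => 1 - ∑ i ∈ extClique K j, clippedExp T (reducedCost K c z i)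
  have h0 : a * ∑ j, (x j - z j) * w j + b * ∑ j, (y j - z j) * w j = 0 := by
    rw [Finset.mul_sum, Finset.mul_sum, ← Finset.sum_add_distrib]
    refine Finset.sum_eq_zero fun j _ => ?_
    have : z j = a * x j + b * y j := by simp [hz]
    rw [this]
    obtain rfl : b = 1 - a := by linarith
    ring
  have h1 : a * smoothedDual K c T z + b * smoothedDual K c T z = smoothedDual K c T z := by
    rw [← add_mul, hab, one_mul]
  simp only [smul_eq_mul]
  linarith

theorem differentiable_smoothedDual (K : Fin m → Finset (Fin n)) (c : Fin n → ℝ) (hT : 0 < T) :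
    Differentiable ℝ (smoothedDual K c T) := by
  rw [funext (smoothedDual_eq K c hT)]
  refine Differentiable.add (by fun_prop) (Differentiable.fun_sum fun i _ => ?_)
  exact Differentiable.comp (fun v => (hasDerivAt_conjEntropy hT v).differentiableAt)
    (differentiable_reducedCost K c i)

/-! ### The clique update as exact coordinate minimization -/

/-- The total mass that the primal point `exp (c^lam / T)` puts on the (extended) clique `j`. -/
def cliqueMass (K : Fin m → Finset (Fin n)) (c : Fin n → ℝ) (T : ℝ) (j : Fin m)
    (lam : Fin m → ℝ) : ℝ :=
  ∑ i ∈ extClique K j, Real.exp (reducedCost K c lam i / T)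

/-- The result of processing the clique `j`, independent of the choice of a maximizer. -/
def cliqueStep (K : Fin m → Finset (Fin n)) (c : Fin n → ℝ) (T : ℝ) (j : Fin m)
    (lam : Fin m → ℝ) : Fin m → ℝ :=
  Function.update lam j (lam j + T * Real.log (cliqueMass K c T j lam))

theorem cliqueMass_pos (K : Fin m → Finset (Fin n)) (c : Fin n → ℝ) (T : ℝ) (j : Fin m)
    (lam : Fin m → ℝ) : 0 < cliqueMass K c T j lam :=
  Finset.sum_pos (fun _ _ => Real.exp_pos _) ⟨Sum.inr j, by simp [extClique]⟩

/-- The factor exp(-c_{i₀}/T) leaves the sum, and its logarithm cancels the added c_{i₀}. -/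
theorem ProcessClique.eq_cliqueStep {K : Fin m → Finset (Fin n)} {c : Fin n → ℝ} (hT : 0 < T)
    {j : Fin m} {lam lam' : Fin m → ℝ} (h : ProcessClique K c T j lam lam') :
    lam' = cliqueStep K c T j lam := by
  obtain ⟨i₀, -, -, rfl⟩ := h
  have h : ∑ i ∈ extClique K j,
      Real.exp ((reducedCost K c lam i - reducedCost K c lam i₀) / T) =
      cliqueMass K c T j lam * Real.exp (-(reducedCost K c lam i₀ / T)) := by
    rw [cliqueMass, Finset.sum_mul]
    refine Finset.sum_congr rfl fun i _ => ?_
    rw [← Real.exp_add]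
    ring_nf
  rw [cliqueStep, h, Real.log_mul (cliqueMass_pos K c T j lam).ne' (Real.exp_pos _).ne',
    Real.log_exp]
  congr 1
  field_simp
  ring

theorem reducedCost_update (K : Fin m → Finset (Fin n)) (c : Fin n → ℝ) (lam : Fin m → ℝ)
    (j : Fin m) (s : ℝ) (i : Var n m) :
    reducedCost K c (Function.update lam j s) i =
      reducedCost K c lam i - if i ∈ extClique K j then s - lam j else 0 := by
  have h := reducedCost_sub K c lam (Function.update lam j s) i
  have h' : ∑ k ∈ cliquesOf K i, (Function.update lam j s k - lam k) =
      if i ∈ extClique K j then s - lam j else 0 := by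
    rw [← Finset.sum_filter_add_sum_filter_not (cliquesOf K i) (fun k => k = j),
      Finset.sum_eq_zero (s := (cliquesOf K i).filter fun k => ¬k = j), add_zero,
      Finset.sum_filter, Finset.sum_ite_eq']
    · simp [cliquesOf]
    · intro k hk
      simp [(Finset.mem_filter.1 hk).2]
  linarith

theorem exp_reducedCost_cliqueStep (K : Fin m → Finset (Fin n)) (c : Fin n → ℝ) (hT : 0 < T)
    (j : Fin m) (lam : Fin m → ℝ) (i : Var n m) :
    Real.exp (reducedCost K c (cliqueStep K c T j lam) i / T) =
      if i ∈ extClique K j then Real.exp (reducedCost K c lam i / T) / cliqueMass K c T j lam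
      else Real.exp (reducedCost K c lam i / T) := by
  rw [cliqueStep, reducedCost_update]
  split_ifs with hi
  · rw [add_sub_cancel_left, sub_div, mul_div_cancel_left₀ _ hT.ne', Real.exp_sub,
      Real.exp_log (cliqueMass_pos K c T j lam)]
  · rw [sub_zero]

theorem cliqueMass_cliqueStep (K : Fin m → Finset (Fin n)) (c : Fin n → ℝ) (hT : 0 < T)
    (j : Fin m) (lam : Fin m → ℝ) :
    cliqueMass K c T j (cliqueStep K c T j lam) = 1 := by
  rw [cliqueMass, Finset.sum_congr rfl fun i hi =>
    (exp_reducedCost_cliqueStep K c hT j lam i).trans (if_pos hi), ← Finset.sum_div]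
  exact div_self (cliqueMass_pos K c T j lam).ne'

/-- Positive terms with sum 1 are each at most 1, so clipping changes nothing. -/
theorem sum_clippedExp_of_cliqueMass_eq_one {K : Fin m → Finset (Fin n)} {c : Fin n → ℝ}
    {j : Fin m} {lam : Fin m → ℝ} (h : cliqueMass K c T j lam = 1) :
    ∑ i ∈ extClique K j, clippedExp T (reducedCost K c lam i) = 1 := by
  rw [← h]
  refine Finset.sum_congr rfl fun i hi => min_eq_right ?_
  rw [← h]
  exact Finset.single_le_sum (f := fun i => Real.exp (reducedCost K c lam i / T))
    (fun _ _ => (Real.exp_pos _).le) hi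

theorem smoothedDual_le_update {K : Fin m → Finset (Fin n)} {c : Fin n → ℝ} (hT : 0 < T)
    {j : Fin m} {lam : Fin m → ℝ} (h : cliqueMass K c T j lam = 1) (s : ℝ) :
    smoothedDual K c T lam ≤ smoothedDual K c T (Function.update lam j s) := by
  refine le_of_eq_of_le ?_ (smoothedDual_subgradient K c hT lam (Function.update lam j s))
  rw [Finset.sum_eq_zero, add_zero]
  intro k _
  rcases eq_or_ne k j with rfl | hk
  · rw [sum_clippedExp_of_cliqueMass_eq_one h, sub_self, mul_zero]
  · rw [Function.update_of_ne hk, sub_self, zero_mul]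

theorem hasDerivAt_smoothedDual_update {K : Fin m → Finset (Fin n)} {c : Fin n → ℝ} (hT : 0 < T)
    {j : Fin m} {lam : Fin m → ℝ} (h : cliqueMass K c T j lam = 1) :
    HasDerivAt (fun s : ℝ => smoothedDual K c T (Function.update lam j s)) 0 (lam j) := by
  have hd : DifferentiableAt ℝ (fun s : ℝ => smoothedDual K c T (Function.update lam j s))
      (lam j) :=
    ((differentiable_smoothedDual K c hT).differentiableAt).comp _
      (hasDerivAt_update lam j (lam j)).differentiableAt
  have hmin : IsLocalMin (fun s : ℝ => smoothedDual K c T (Function.update lam j s)) (lam j) :=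
    Eventually.of_forall fun s => by
      simpa using smoothedDual_le_update hT h s
  simpa [hmin.deriv_eq_zero] using hd.hasDerivAt

theorem smoothedDual_le_of_cliqueMass_eq_one {K : Fin m → Finset (Fin n)} {c : Fin n → ℝ}
    (hT : 0 < T) {lam : Fin m → ℝ} (h : ∀ j, cliqueMass K c T j lam = 1) (mu : Fin m → ℝ) :
    smoothedDual K c T lam ≤ smoothedDual K c T mu := by
  refine le_of_eq_of_le ?_ (smoothedDual_subgradient K c hT lam mu)
  rw [Finset.sum_eq_zero, add_zero]
  intro j _
  rw [sum_clippedExp_of_cliqueMass_eq_one (h j), sub_self, mul_zero]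

/-! ### The unclipped dual as a Lyapunov function -/

/-- The dual of the entropy-smoothed relaxation without the upper bounds `x ≤ 1`. -/
def expDual (K : Fin m → Finset (Fin n)) (c : Fin n → ℝ) (T : ℝ) (lam : Fin m → ℝ) : ℝ :=
  ∑ j, lam j + T * ∑ i, Real.exp (reducedCost K c lam i / T)

theorem expDual_cliqueStep (K : Fin m → Finset (Fin n)) (c : Fin n → ℝ) (hT : 0 < T)
    (j : Fin m) (lam : Fin m → ℝ) :
    expDual K c T (cliqueStep K c T j lam) = expDual K c T lam -
      T * (cliqueMass K c T j lam - 1 - Real.log (cliqueMass K c T j lam)) := by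
  have h1 : ∑ k, cliqueStep K c T j lam k =
      ∑ k, lam k + T * Real.log (cliqueMass K c T j lam) := by
    rw [cliqueStep, Finset.sum_update_of_mem (Finset.mem_univ j),
      ← Finset.add_sum_erase _ _ (Finset.mem_univ j), Finset.sdiff_singleton_eq_erase]
    ring
  have h2 : ∀ mu, ∑ i, Real.exp (reducedCost K c mu i / T) = cliqueMass K c T j mu +
      ∑ i ∈ (extClique K j)ᶜ, Real.exp (reducedCost K c mu i / T) := fun mu =>
    (Finset.sum_add_sum_compl _ _).symm
  have h3 : ∑ i ∈ (extClique K j)ᶜ, Real.exp (reducedCost K c (cliqueStep K c T j lam) i / T) =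
      ∑ i ∈ (extClique K j)ᶜ, Real.exp (reducedCost K c lam i / T) :=
    Finset.sum_congr rfl fun i hi =>
      (exp_reducedCost_cliqueStep K c hT j lam i).trans (if_neg (Finset.mem_compl.1 hi))
  rw [expDual, expDual, h1, h2, h2, h3, cliqueMass_cliqueStep K c hT]
  ring

theorem expDual_cliqueStep_le (K : Fin m → Finset (Fin n)) (c : Fin n → ℝ) (hT : 0 < T)
    (j : Fin m) (lam : Fin m → ℝ) :
    expDual K c T (cliqueStep K c T j lam) ≤ expDual K c T lam := by
  rw [expDual_cliqueStep K c hT]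
  have := Real.log_le_sub_one_of_pos (cliqueMass_pos K c T j lam)
  nlinarith

theorem cliqueMass_eq_one_of_expDual_cliqueStep_eq {K : Fin m → Finset (Fin n)} {c : Fin n → ℝ}
    (hT : 0 < T) {j : Fin m} {lam : Fin m → ℝ}
    (h : expDual K c T (cliqueStep K c T j lam) = expDual K c T lam) :
    cliqueMass K c T j lam = 1 := by
  by_contra hne
  rw [expDual_cliqueStep K c hT] at h
  have := Real.log_lt_sub_one_of_pos (cliqueMass_pos K c T j lam) hne
  nlinarith

theorem cliqueStep_eq_self {K : Fin m → Finset (Fin n)} {c : Fin n → ℝ} {j : Fin m}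
    {lam : Fin m → ℝ} (h : cliqueMass K c T j lam = 1) : cliqueStep K c T j lam = lam := by
  simp [cliqueStep, h]

theorem continuous_cliqueStep (K : Fin m → Finset (Fin n)) (c : Fin n → ℝ) (T : ℝ) (j : Fin m) :
    Continuous (cliqueStep K c T j) := by
  have h : Continuous (cliqueMass K c T j) := continuous_finsetSum _ fun i _ =>
    Real.continuous_exp.comp ((continuous_reducedCost K c i).div_const T)
  exact continuous_id.update j ((continuous_apply j).add
    (continuous_const.mul (h.log fun lam => (cliqueMass_pos K c T j lam).ne')))

theorem continuous_expDual (K : Fin m → Finset (Fin n)) (c : Fin n → ℝ) (T : ℝ) :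
    Continuous (expDual K c T) := by
  have h : Continuous fun lam => ∑ i, Real.exp (reducedCost K c lam i / T) :=
    continuous_finsetSum _ fun i _ =>
      Real.continuous_exp.comp ((continuous_reducedCost K c i).div_const T)
  unfold expDual
  fun_prop

/-- Coercivity: the slack of clique k has reduced cost -λ_k, and `2 * y ≤ exp y` at y = -λ_k/T
outweighs a negative λ_k. -/
theorem abs_le_expDual (K : Fin m → Finset (Fin n)) (c : Fin n → ℝ) (hT : 0 < T)
    (lam : Fin m → ℝ) (j : Fin m) : |lam j| ≤ expDual K c T lam := by
  have h1 : ∀ k, |lam k| ≤ lam k + T * Real.exp (-lam k / T) := by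
    intro k
    have hp := mul_pos hT (Real.exp_pos (-lam k / T))
    have h := mul_le_mul_of_nonneg_left (Real.two_mul_le_exp (x := -lam k / T)) hT.le
    have e : T * (2 * (-lam k / T)) = -(2 * lam k) := by
      field_simp
    rw [abs_le']
    constructor <;> linarith
  calc |lam j| ≤ ∑ k, |lam k| :=
        Finset.single_le_sum (f := fun k => |lam k|) (fun _ _ => abs_nonneg _) (Finset.mem_univ j)
    _ ≤ ∑ k, (lam k + T * Real.exp (-lam k / T)) := Finset.sum_le_sum fun k _ => h1 k
    _ ≤ expDual K c T lam := by
        rw [expDual, Fintype.sum_sum_type, Finset.sum_add_distrib, ← Finset.mul_sum]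
        simp only [reducedCost_inr]
        have : 0 ≤ T * ∑ i : Fin n, Real.exp (reducedCost K c lam (Sum.inl i) / T) :=
          mul_nonneg hT.le (Finset.sum_nonneg fun _ _ => (Real.exp_pos _).le)
        linarith

/-- Strict monotonicity of exp: the products of differences are nonnegative and, as all masses
agree, sum to 0. So the reduced costs agree, and the slack ones determine λ. -/
theorem eq_of_cliqueMass_eq_one {K : Fin m → Finset (Fin n)} {c : Fin n → ℝ} (hT : 0 < T)
    {lam mu : Fin m → ℝ} (h : ∀ j, cliqueMass K c T j lam = 1)
    (h' : ∀ j, cliqueMass K c T j mu = 1) : lam = mu := by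
  set a := fun i => reducedCost K c lam i
  set b := fun i => reducedCost K c mu i
  have hnn : ∀ i, 0 ≤ (Real.exp (a i / T) - Real.exp (b i / T)) * (a i - b i) := by
    intro i
    rcases le_total (a i) (b i) with hi | hi
    · exact mul_nonneg_of_nonpos_of_nonpos
        (sub_nonpos.2 (Real.exp_le_exp.2 (div_le_div_of_nonneg_right hi hT.le)))
        (sub_nonpos.2 hi)
    · exact mul_nonneg
        (sub_nonneg.2 (Real.exp_le_exp.2 (div_le_div_of_nonneg_right hi hT.le)))
        (sub_nonneg.2 hi)
  have hsum : ∑ i, (Real.exp (a i / T) - Real.exp (b i / T)) * (a i - b i) = 0 := by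
    simp only [a, b, reducedCost_sub, mul_neg, Finset.sum_neg_distrib]
    rw [sum_mul_sum_cliquesOf, neg_eq_zero]
    refine Finset.sum_eq_zero fun j _ => ?_
    have e1 := h j
    have e2 := h' j
    rw [cliqueMass] at e1 e2
    rw [Finset.sum_sub_distrib, e1, e2, sub_self, mul_zero]
  rw [Finset.sum_eq_zero_iff_of_nonneg fun i _ => hnn i] at hsum
  funext j
  have hab : a (Sum.inr j) = b (Sum.inr j) := by
    rcases mul_eq_zero.1 (hsum (Sum.inr j) (Finset.mem_univ _)) with hj | hj
    · have := Real.exp_injective (sub_eq_zero.1 hj)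
      exact (div_left_inj' hT.ne').1 this
    · exact sub_eq_zero.1 hj
  simpa [a, b, reducedCost_inr] using hab

/-! ### Sweeps and convergence of the iterates -/

/-- The result of processing the first `p` cliques. -/
def partialSweep (K : Fin m → Finset (Fin n)) (c : Fin n → ℝ) (T : ℝ) (p : Fin (m + 1)) :
    (Fin m → ℝ) → Fin m → ℝ :=
  Fin.induction (motive := fun _ => (Fin m → ℝ) → Fin m → ℝ) id
    (fun j f lam => cliqueStep K c T j (f lam)) p

theorem partialSweep_succ (K : Fin m → Finset (Fin n)) (c : Fin n → ℝ) (T : ℝ) (j : Fin m)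
    (lam : Fin m → ℝ) :
    partialSweep K c T j.succ lam = cliqueStep K c T j (partialSweep K c T j.castSucc lam) := rfl

theorem continuous_partialSweep (K : Fin m → Finset (Fin n)) (c : Fin n → ℝ) (T : ℝ)
    (p : Fin (m + 1)) : Continuous (partialSweep K c T p) := by
  induction p using Fin.induction with
  | zero => exact continuous_id
  | succ j ih => exact (continuous_cliqueStep K c T j).comp ih

theorem antitone_expDual_partialSweep (K : Fin m → Finset (Fin n)) (c : Fin n → ℝ) (hT : 0 < T)
    (lam : Fin m → ℝ) : Antitone fun p => expDual K c T (partialSweep K c T p lam) :=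
  Fin.antitone_iff_succ_le.2 fun j => by
    simpa only [partialSweep_succ] using expDual_cliqueStep_le K c hT j _

/-- No step of the sweep can lose anything, so each meets mass 1 and leaves the vector fixed. -/
theorem partialSweep_eq_self_and_cliqueMass_eq_one {K : Fin m → Finset (Fin n)} {c : Fin n → ℝ}
    (hT : 0 < T) {lam : Fin m → ℝ}
    (h : expDual K c T (partialSweep K c T (Fin.last m) lam) = expDual K c T lam) :
    (∀ p, partialSweep K c T p lam = lam) ∧ ∀ j, cliqueMass K c T j lam = 1 := by
  have hall : ∀ p, expDual K c T (partialSweep K c T p lam) = expDual K c T lam := fun p =>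
    le_antisymm (antitone_expDual_partialSweep K c hT lam (Fin.zero_le p))
      (h.symm.trans_le (antitone_expDual_partialSweep K c hT lam (Fin.le_last p)))
  have hmass : ∀ j : Fin m, cliqueMass K c T j (partialSweep K c T j.castSucc lam) = 1 :=
    fun j => cliqueMass_eq_one_of_expDual_cliqueStep_eq hT <| by
      rw [← partialSweep_succ, hall, hall]
  have hfix : ∀ p, partialSweep K c T p lam = lam := by
    intro p
    induction p using Fin.induction with
    | zero => rfl
    | succ j ih => rw [partialSweep_succ, cliqueStep_eq_self (hmass j), ih]
  exact ⟨hfix, fun j => by simpa only [hfix] using hmass j⟩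

theorem IsRun.eq_partialSweep {K : Fin m → Finset (Fin n)} {c : Fin n → ℝ} (hT : 0 < T)
    {lam : ℕ → Fin (m + 1) → Fin m → ℝ} (h : IsRun K c T lam) (t : ℕ) (p : Fin (m + 1)) :
    lam t p = partialSweep K c T p (lam t 0) := by
  induction p using Fin.induction with
  | zero => rfl
  | succ j ih => rw [partialSweep_succ, ← ih, (h.inner t j).eq_cliqueStep hT]

theorem IsRun.exists_tendsto {K : Fin m → Finset (Fin n)} {c : Fin n → ℝ} (hT : 0 < T)
    {lam : ℕ → Fin (m + 1) → Fin m → ℝ} (h : IsRun K c T lam) :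
    ∃ lamOpt : Fin m → ℝ, (∀ j, cliqueMass K c T j lamOpt = 1) ∧
      ∀ p, Tendsto (fun t => lam t p) atTop (𝓝 lamOpt) := by
  set u : ℕ → Fin m → ℝ := fun t => lam t 0
  have hu : ∀ t, u (t + 1) = partialSweep K c T (Fin.last m) (u t) := fun t =>
    (h.outer t).trans (h.eq_partialSweep hT t _)
  have hanti : Antitone fun t => expDual K c T (u t) := antitone_nat_of_succ_le fun t => by
    rw [hu]
    exact antitone_expDual_partialSweep K c hT (u t) (Fin.zero_le _)
  have hbdd : ∀ t j, |u t j| ≤ expDual K c T (u 0) := fun t j =>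
    (abs_le_expDual K c hT (u t) j).trans (hanti (Nat.zero_le t))
  have hmem : ∀ t, u t ∈ Set.Icc (fun _ => -expDual K c T (u 0)) fun _ => expDual K c T (u 0) :=
    fun t => ⟨fun j => (abs_le.1 (hbdd t j)).1, fun j => (abs_le.1 (hbdd t j)).2⟩
  have hcompact : IsCompact
      (Set.Icc (fun _ : Fin m => -expDual K c T (u 0)) fun _ => expDual K c T (u 0)) :=
    isCompact_Icc
  obtain ⟨L, hL⟩ : ∃ L, Tendsto (fun t => expDual K c T (u t)) atTop (𝓝 L) := by
    -- The lower bound 0 needs some clique; for m = 0 the sequence is constant.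
    rcases isEmpty_or_nonempty (Fin m) with hm | ⟨⟨j⟩⟩
    · exact ⟨expDual K c T (u 0), tendsto_const_nhds.congr fun t => by
        rw [Subsingleton.elim (u t) (u 0)]⟩
    · exact ⟨_, tendsto_atTop_ciInf hanti
        ⟨0, by rintro _ ⟨t, rfl⟩; exact (abs_nonneg _).trans (abs_le_expDual K c hT (u t) j)⟩⟩
  have hL' : Tendsto (fun t => expDual K c T (partialSweep K c T (Fin.last m) (u t))) atTop
      (𝓝 L) := by
    simp only [← hu]
    exact hL.comp (tendsto_add_atTop_nat 1)
  have hcluster : ∀ y, MapClusterPt y atTop u →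
      (∀ p, partialSweep K c T p y = y) ∧ ∀ j, cliqueMass K c T j y = 1 := by
    intro y hy
    obtain ⟨φ, hφ, hφy⟩ := hy.tendsto_subseq
    refine partialSweep_eq_self_and_cliqueMass_eq_one hT ?_
    -- Along the subsequence the potential has limit L both before and after a sweep.
    have e1 := tendsto_nhds_unique (((continuous_expDual K c T).tendsto y).comp hφy)
      (hL.comp hφ.tendsto_atTop)
    have e2 := tendsto_nhds_unique ((((continuous_expDual K c T).comp
      (continuous_partialSweep K c T (Fin.last m))).tendsto y).comp hφy)
      (hL'.comp hφ.tendsto_atTop)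
    exact e2.trans e1.symm
  obtain ⟨x, -, hx⟩ := hcompact.exists_mapClusterPt
    (tendsto_principal.2 (Eventually.of_forall hmem) : Tendsto u atTop _)
  have hxu : Tendsto u atTop (𝓝 x) := hcompact.tendsto_nhds_of_unique_mapClusterPt
    (Eventually.of_forall hmem) fun y _ hy =>
      eq_of_cliqueMass_eq_one hT (hcluster y hy).2 (hcluster x hx).2
  refine ⟨x, (hcluster x hx).2, fun p => ?_⟩
  have := ((continuous_partialSweep K c T p).tendsto x).comp hxu
  rw [(hcluster x hx).1 p] at this
  exact this.congr fun t => (h.eq_partialSweep hT t p).symm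

end CliqueMWIS

end

theorem mainTheorem4 {n m : ℕ} (G : SimpleGraph (Fin n)) (K : Fin m → Finset (Fin n))
    (hK : CliqueMWIS.IsCliqueCover G K) (c : Fin n → ℝ) (T : ℝ) (hT : 0 < T) :
    -- the smoothed dual is convex and differentiable
    ConvexOn ℝ Set.univ (CliqueMWIS.smoothedDual K c T) ∧
    Differentiable ℝ (CliqueMWIS.smoothedDual K c T) ∧
    -- processing a clique is an exact minimization over its coordinate
    (∀ (j : Fin m) (lam lam' : Fin m → ℝ), CliqueMWIS.ProcessClique K c T j lam lam' →
      HasDerivAt (fun s : ℝ => CliqueMWIS.smoothedDual K c T (Function.update lam' j s))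
        0 (lam' j) ∧
      (∀ k, k ≠ j → lam' k = lam k) ∧
      ∀ s : ℝ, CliqueMWIS.smoothedDual K c T lam' ≤
        CliqueMWIS.smoothedDual K c T (Function.update lam j s)) ∧
    -- all iterates converge to a minimizer, and their values to the minimum
    (∀ lam : ℕ → Fin (m + 1) → Fin m → ℝ, CliqueMWIS.IsRun K c T lam →
      ∃ lamOpt : Fin m → ℝ,
        (∀ mu : Fin m → ℝ,
          CliqueMWIS.smoothedDual K c T lamOpt ≤ CliqueMWIS.smoothedDual K c T mu) ∧
        ∀ p : Fin (m + 1),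
          Tendsto (fun t => lam t p) atTop (𝓝 lamOpt) ∧
          Tendsto (fun t => CliqueMWIS.smoothedDual K c T (lam t p)) atTop
            (𝓝 (CliqueMWIS.smoothedDual K c T lamOpt))) := by
  refine ⟨CliqueMWIS.convexOn_smoothedDual K c hT, CliqueMWIS.differentiable_smoothedDual K c hT,
    fun j lam lam' h => ?_, fun lam h => ?_⟩
  · obtain rfl := h.eq_cliqueStep hT
    have hmass := CliqueMWIS.cliqueMass_cliqueStep K c hT j lam
    refine ⟨CliqueMWIS.hasDerivAt_smoothedDual_update hT hmass,
      fun k hk => Function.update_of_ne hk _ _, fun s => ?_⟩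
    -- The old and new vectors span the same coordinate line.
    have := CliqueMWIS.smoothedDual_le_update hT hmass s
    rwa [CliqueMWIS.cliqueStep, Function.update_idem] at this
  · obtain ⟨x, hx, hlim⟩ := h.exists_tendsto hT
    exact ⟨x, CliqueMWIS.smoothedDual_le_of_cliqueMass_eq_one hT hx, fun p => ⟨hlim p,
      ((CliqueMWIS.differentiable_smoothedDual K c hT).continuous.tendsto x).comp (hlim p)⟩⟩
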